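/- Let $\mathbb{S}$ be the sphere of purely imaginary unit quaternions and, for $I\in\mathbb{S}$, let $\mathbb{C}_I=\{x+Iy : x,y\in\mathbb{R}\}$ with area measure $m_I$. A real differentiable function $f:\mathbb{H}\to\mathbb{H}$ is called entire (left) slice regular if $\frac12\left(\frac{\partial}{\partial x}+I\frac{\partial}{\partial y}\right)f(x+Iy)=0$ for all $I\in\mathbb{S}$ and $x,y\in\mathbb{R}$. For $0<p<\infty$, $\alpha>0$, $I\in\mathbb{S}$ and $f:\mathbb{H}\to\mathbb{H}$ continuous put $$\|f\|_{p,\alpha,I}=\left(\frac{\alpha p}{2\pi}\int_{\mathbb{C}_I}|f(q)|^p\left(e^{-\alpha|q|^2/2}\right)^p\,dm_I(q)\right)^{1/p}\in[0,\infty].$$ The Fock space of the second kind $\mathcal{F}^{\alpha,p}_{Slice}(\mathbb{H})$ consists of all entire slice regular functions $f$ such that $\|f\|_{p,\alpha,I}<\infty$ for some $I\in\mathbb{S}$. **Theorem.** Let $0<p<\infty$, $0<\alpha<\infty$ and $f\in\mathcal{F}^{\alpha,p}_{Slice}(\mathbb{H})$. Then there exists a sequence $(P_n)_{n\in\mathbb{N}}$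 of quaternionic polynomials with coefficients on the right, $P_n(q)=\sum_{k=0}^{d_n}q^k a_{n,k}$ with $a_{n,k}\in\mathbb{H}$, such that for every $I\in\mathbb{S}$ $$\|P_n-f\|_{p,\alpha,I}\to 0\quad\text{as } n\to\infty.$$ -/

import Mathlib

open MeasureTheory Filter
open scoped Quaternion ENNReal Topology

namespace SliceFock

/-- The sphere `𝕊` of purely imaginary unit quaternions. -/
def imagUnits : Set ℍ[ℝ] :=
  {q | q.re = 0 ∧ q.imI ^ 2 + q.imJ ^ 2 + q.imK ^ 2 = 1}

/-- The parametrization `x + iy ↦ x + Iy` of the slice `ℂ_I` by the complex plane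
(an isometry onto `ℂ_I` for `I ∈ 𝕊`). -/
noncomputable def slicePt (I : ℍ[ℝ]) (z : ℂ) : ℍ[ℝ] :=
  (z.re : ℍ[ℝ]) + I * (z.im : ℍ[ℝ])

/-- The operator `½ (∂/∂x + I ∂/∂y)` applied to the restriction of `f` to `ℂ_I`,
at the point `x + Iy`. -/
noncomputable def sliceDbar (I : ℍ[ℝ]) (f : ℍ[ℝ] → ℍ[ℝ]) (x y : ℝ) : ℍ[ℝ] :=
  (1 / 2 : ℝ) •
    (deriv (fun s : ℝ => f (slicePt I ⟨s, y⟩)) x +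
      I * deriv (fun t : ℝ => f (slicePt I ⟨x, t⟩)) y)

/-- Entire (left) slice regular functions, `𝒮ℛ(ℍ)`. -/
structure IsEntireSliceRegular (f : ℍ[ℝ] → ℍ[ℝ]) : Prop where
  differentiable : Differentiable ℝ f
  dbar_eq_zero : ∀ I ∈ imagUnits, ∀ x y : ℝ, sliceDbar I f x y = 0

/-- The slice (quasi-)norm
`‖f‖_{p,α,I} = ((αp/2π) ∫_{ℂ_I} |f(q)|^p (e^{-α|q|²/2})^p dm_I(q))^{1/p}`, with values in `[0,∞]`.
The area measure on `ℂ_I` is Lebesgue measure on `ℂ` transported by `slicePt I`. -/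
noncomputable def sliceNorm (p α : ℝ) (I : ℍ[ℝ]) (f : ℍ[ℝ] → ℍ[ℝ]) : ℝ≥0∞ :=
  (ENNReal.ofReal (α * p / (2 * Real.pi)) *
    ∫⁻ z : ℂ, ENNReal.ofReal
      (‖f (slicePt I z)‖ ^ p * (Real.exp (-α * ‖slicePt I z‖ ^ 2 / 2)) ^ p)) ^ (1 / p)

/-- The space `𝓕^p_{α,I}(ℍ)` of entire slice regular functions with `‖f‖_{p,α,I} < ∞`. -/
def fockOnSlice (p α : ℝ) (I : ℍ[ℝ]) : Set (ℍ[ℝ] → ℍ[ℝ]) :=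
  {f | IsEntireSliceRegular f ∧ sliceNorm p α I f < ∞}

/-- The Fock space of the second kind `𝓕^{α,p}_{Slice}(ℍ)`: entire slice regular functions that
belong to `𝓕^p_{α,I}(ℍ)` for some `I ∈ 𝕊`. -/
def fockSecondKind (α p : ℝ) : Set (ℍ[ℝ] → ℍ[ℝ]) :=
  {f | IsEntireSliceRegular f ∧ ∃ I ∈ imagUnits, f ∈ fockOnSlice p α I}

/-- The value at `q` of the quaternionic polynomial `∑ q^k a_k`, with the coefficients written on
the right (`Polynomial.eval` would put them on the left). -/
noncomputable def rightEval (P : Polynomial ℍ[ℝ]) (q : ℍ[ℝ]) : ℍ[ℝ] :=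
  P.sum fun k a => q ^ k * a

end SliceFock

/-! Left multiplication by `ℂ_I` makes `ℍ` a complex Banach space in which the restriction of a
slice regular function to `ℂ_I` is an entire function `F`. On a slice where the norm is finite, the
claim is therefore one about vector-valued Fock spaces: dilate, then truncate the Taylor series.

Dilations `F (r • z)` tend to `F` by dominated convergence (`tendsto_fockIntegral_dilation_sub`). A
local mean value estimate bounds `‖F z‖` by `C exp (α (‖z‖ + 1)² / 2)`; after a proper dilation the
Gaussian weight beats this with room to spare, and Cauchy's estimates make the Taylor polynomials
converge geometrically (`tendsto_fockIntegral_taylor_dilation`).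

All slices share the real axis, so one power series represents `f` on `ℍ`. The representation
formula then bounds the error on any slice by the error on the first one (`fockIntegral_slice_le`),
and the same polynomials serve every slice. -/

namespace SliceFock

/-! ### Fock integrals of vector-valued functions and pointwise growth -/

section Fock

variable {E : Type*} [NormedAddCommGroup E]

/-- The weighted density `‖F z‖ ^ p (e ^ (-α ‖z‖² / 2)) ^ p` of the Fock (quasi-)norm. -/
noncomputable def fockDensity (p α : ℝ) (F : ℂ → E) (z : ℂ) : ℝ :=
  ‖F z‖ ^ p * (Real.exp (-α * ‖z‖ ^ 2 / 2)) ^ p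

/-- The `p`-th power of the Fock (quasi-)norm of `F`, without the normalizing constant. -/
noncomputable def fockIntegral (p α : ℝ) (F : ℂ → E) : ℝ≥0∞ :=
  ∫⁻ z : ℂ, ENNReal.ofReal (fockDensity p α F z)

lemma fockDensity_nonneg (p α : ℝ) (F : ℂ → E) (z : ℂ) : 0 ≤ fockDensity p α F z := by
  unfold fockDensity; positivity

lemma continuous_fockDensity {p : ℝ} (hp : 0 < p) (α : ℝ) {F : ℂ → E} (hF : Continuous F) :
    Continuous (fockDensity p α F) := by
  unfold fockDensity
  refine (hF.norm.rpow_const fun _ => Or.inr hp.le).mul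
    (Continuous.rpow_const ?_ fun _ => Or.inr hp.le)
  fun_prop

/-- Comparing `a + b` with `2 max a b` needs no convexity, so `p < 1` is allowed; this replaces the
triangle inequality throughout. -/
lemma rpow_le_two_rpow_mul_add {p a b c : ℝ} (hp : 0 < p) (ha : 0 ≤ a) (hb : 0 ≤ b) (hc : 0 ≤ c)
    (h : c ≤ a + b) : c ^ p ≤ 2 ^ p * (a ^ p + b ^ p) := by
  have h1 : c ≤ 2 * max a b := by
    have := le_max_left a b; have := le_max_right a b; linarith
  calc c ^ p ≤ (2 * max a b) ^ p := Real.rpow_le_rpow hc h1 hp.le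
    _ = 2 ^ p * max a b ^ p := Real.mul_rpow (by norm_num) (le_max_of_le_left ha)
    _ ≤ 2 ^ p * (a ^ p + b ^ p) := by
      gcongr
      have := Real.rpow_nonneg ha p
      have := Real.rpow_nonneg hb p
      rcases max_cases a b with h | h <;> rw [h.1] <;> linarith

lemma fockDensity_le_of_norm_le_add {p : ℝ} (hp : 0 < p) (α : ℝ) {F G H : ℂ → E} {z : ℂ}
    (h : ‖H z‖ ≤ ‖F z‖ + ‖G z‖) :
    fockDensity p α H z ≤ 2 ^ p * (fockDensity p α F z + fockDensity p α G z) := by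
  unfold fockDensity
  rw [← add_mul, ← mul_assoc]
  gcongr
  exact rpow_le_two_rpow_mul_add hp (norm_nonneg _) (norm_nonneg _) (norm_nonneg _) h

lemma fockIntegral_le_of_norm_le_add {p : ℝ} (hp : 0 < p) (α : ℝ) {F G H : ℂ → E}
    (hF : Continuous F) (h : ∀ z, ‖H z‖ ≤ ‖F z‖ + ‖G z‖) :
    fockIntegral p α H ≤ ENNReal.ofReal (2 ^ p) * (fockIntegral p α F + fockIntegral p α G) := by
  unfold fockIntegral
  rw [← lintegral_add_left (continuous_fockDensity hp α hF).measurable.ennreal_ofReal,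
    ← lintegral_const_mul' _ _ ENNReal.ofReal_ne_top]
  refine lintegral_mono fun z => ?_
  rw [← ENNReal.ofReal_add (fockDensity_nonneg _ _ _ _) (fockDensity_nonneg _ _ _ _),
    ← ENNReal.ofReal_mul (by positivity)]
  exact ENNReal.ofReal_le_ofReal (fockDensity_le_of_norm_le_add hp α (h z))

variable [NormedSpace ℂ E]

/-- The sub-mean value property of `‖F‖ ^ p` on unit discs, up to a constant, for every `p > 0`. -/
lemma exists_norm_rpow_le_lintegral_ball {p : ℝ} (hp : 0 < p) :
    ∃ C : ℝ, 0 ≤ C ∧ ∀ F : ℂ → E, Differentiable ℂ F → ∀ c : ℂ,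
      ENNReal.ofReal (‖F c‖ ^ p) ≤
        ENNReal.ofReal C * ∫⁻ w in Metric.ball c 1, ENNReal.ofReal (‖F w‖ ^ p) := by
  set K : ℝ := 2 ^ (2 / p) with hK
  have hK0 : 0 < K := by positivity
  refine ⟨2 ^ p * 16 * (K + 1) ^ 2 / Real.pi, by positivity, fun F hF c => ?_⟩
  -- The weight vanishes on the unit circle, which pushes the maximum point inside. With exponent `2
  -- / p`, its `p`-th power is `d ^ 2`, matching the area of a disc of radius comparable to `d`.
  have hcont : Continuous fun w => (1 - ‖w - c‖) ^ (2 / p) * ‖F w‖ := by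
    refine Continuous.mul (Continuous.rpow_const (by fun_prop) fun _ => Or.inr (by positivity))
      hF.continuous.norm
  obtain ⟨z₀, hz₀, hmax⟩ := (isCompact_closedBall c 1).exists_isMaxOn
    ⟨c, Metric.mem_closedBall_self zero_le_one⟩ hcont.continuousOn
  rcases (norm_nonneg (F c)).eq_or_lt with hc | hc
  · rw [← hc, Real.zero_rpow hp.ne']; simp
  set d : ℝ := 1 - ‖z₀ - c‖ with hd
  have hd0 : 0 ≤ d := by
    have := mem_closedBall_iff_norm.1 hz₀; linarith
  have hM : ‖F c‖ ≤ d ^ (2 / p) * ‖F z₀‖ := by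
    have := hmax (Metric.mem_closedBall_self zero_le_one : c ∈ Metric.closedBall c 1)
    simpa using this
  have hdpos : 0 < d := by
    rcases hd0.eq_or_lt with h | h
    · rw [← h, Real.zero_rpow (by positivity)] at hM; linarith
    · exact h
  have hFz₀ : 0 < ‖F z₀‖ := by
    by_contra h
    have : ‖F z₀‖ = 0 := le_antisymm (not_lt.1 h) (norm_nonneg _)
    rw [this] at hM; linarith
  have hsub : ∀ w ∈ Metric.ball z₀ (d / 2), d / 2 ≤ 1 - ‖w - c‖ := fun w hw => by
    have h1 := mem_ball_iff_norm.1 hw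
    have h2 : ‖w - c‖ ≤ ‖w - z₀‖ + ‖z₀ - c‖ := norm_sub_le_norm_sub_add_norm_sub _ _ _
    linarith
  -- On this disc the distance to the unit circle at most halves, so maximality costs only the
  -- factor `K = 2 ^ (2 / p)`.
  have hbd : ∀ w ∈ Metric.ball z₀ (d / 2), ‖F w‖ ≤ K * ‖F z₀‖ := fun w hw => by
    have h1 := hsub w hw
    have h2 : w ∈ Metric.closedBall c 1 := mem_closedBall_iff_norm.2 (by linarith)
    have h3 : (1 - ‖w - c‖) ^ (2 / p) * ‖F w‖ ≤ d ^ (2 / p) * ‖F z₀‖ := hmax h2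
    have h4 : (d / 2) ^ (2 / p) * ‖F w‖ ≤ (1 - ‖w - c‖) ^ (2 / p) * ‖F w‖ := by
      gcongr
    have h5 : d ^ (2 / p) = (d / 2) ^ (2 / p) * K := by
      rw [hK, ← Real.mul_rpow (by positivity) (by norm_num)]; congr 1; ring
    have h6 : (d / 2) ^ (2 / p) * ‖F w‖ ≤ (d / 2) ^ (2 / p) * (K * ‖F z₀‖) := by
      rw [← mul_assoc, ← h5]; exact h4.trans h3
    exact le_of_mul_le_mul_left h6 (by positivity)
  have hmaps : Set.MapsTo F (Metric.ball z₀ (d / 2))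
      (Metric.closedBall (F z₀) ((K + 1) * ‖F z₀‖)) := fun w hw => by
    rw [mem_closedBall_iff_norm]
    have := hbd w hw
    have := norm_sub_le (F w) (F z₀)
    linarith
  -- With this radius the Schwarz lemma keeps `F` within `‖F z₀‖ / 2` of `F z₀`.
  set σ : ℝ := d / (4 * (K + 1)) with hσ
  have hσ0 : 0 < σ := by positivity
  have hσd : σ ≤ d / 2 := by
    rw [hσ, div_le_div_iff₀ (by positivity) (by norm_num)]; nlinarith
  have hlow : ∀ w ∈ Metric.ball z₀ σ, ‖F z₀‖ / 2 ≤ ‖F w‖ := fun w hw => by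
    have h1 := Complex.dist_le_div_mul_dist_of_mapsTo_ball hF.differentiableOn hmaps
      (Metric.ball_subset_ball hσd hw)
    have h2 : (K + 1) * ‖F z₀‖ / (d / 2) * dist w z₀ ≤ (K + 1) * ‖F z₀‖ / (d / 2) * σ := by
      gcongr; exact (Metric.mem_ball.1 hw).le
    have h3 : (K + 1) * ‖F z₀‖ / (d / 2) * σ = ‖F z₀‖ / 2 := by
      rw [hσ]; field_simp; norm_num
    have h4 : ‖F z₀‖ - ‖F w‖ ≤ dist (F w) (F z₀) := by
      rw [dist_comm, dist_eq_norm]; exact norm_sub_norm_le _ _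
    linarith
  have hint : ENNReal.ofReal ((‖F z₀‖ / 2) ^ p * (σ ^ 2 * Real.pi)) ≤
      ∫⁻ w in Metric.ball c 1, ENNReal.ofReal (‖F w‖ ^ p) := by
    calc ENNReal.ofReal ((‖F z₀‖ / 2) ^ p * (σ ^ 2 * Real.pi))
        = ∫⁻ _ in Metric.ball z₀ σ, ENNReal.ofReal ((‖F z₀‖ / 2) ^ p) := by
          rw [setLIntegral_const, Complex.volume_ball, ENNReal.ofReal_mul (by positivity),
            ENNReal.ofReal_mul (by positivity), ENNReal.ofReal_pow hσ0.le]
          congr 2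
          rw [ENNReal.ofReal, Real.toNNReal_of_nonneg Real.pi_pos.le]; rfl
      _ ≤ ∫⁻ w in Metric.ball z₀ σ, ENNReal.ofReal (‖F w‖ ^ p) := by
          refine setLIntegral_mono' measurableSet_ball fun w hw => ?_
          exact ENNReal.ofReal_le_ofReal (Real.rpow_le_rpow (by positivity) (hlow w hw) hp.le)
      _ ≤ _ := lintegral_mono_set fun w hw => by
          have := hsub w (Metric.ball_subset_ball hσd hw)
          exact mem_ball_iff_norm.2 (by linarith)
  refine le_trans ?_ (mul_le_mul_right hint _)
  rw [← ENNReal.ofReal_mul (by positivity)]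
  refine ENNReal.ofReal_le_ofReal ?_
  calc ‖F c‖ ^ p ≤ (d ^ (2 / p) * ‖F z₀‖) ^ p := Real.rpow_le_rpow hc.le hM hp.le
    _ = d ^ 2 * ‖F z₀‖ ^ p := by
      rw [Real.mul_rpow (by positivity) hFz₀.le, ← Real.rpow_mul hd0, div_mul_cancel₀ _ hp.ne']
      norm_num
    _ = _ := by
      rw [Real.div_rpow hFz₀.le (by norm_num), hσ]
      have : (0:ℝ) < 2 ^ p := by positivity
      field_simp
      norm_num

/-- Entire functions in the Fock space have order at most two and type at most `α / 2`. -/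
lemma exists_norm_le_of_fockIntegral_lt_top {p α : ℝ} (hp : 0 < p) (hα : 0 < α) {F : ℂ → E}
    (hF : Differentiable ℂ F) (hfin : fockIntegral p α F < ∞) :
    ∃ C : ℝ, 0 ≤ C ∧ ∀ z, ‖F z‖ ≤ C * Real.exp (α * (‖z‖ + 1) ^ 2 / 2) := by
  obtain ⟨C₀, hC₀, h⟩ := exists_norm_rpow_le_lintegral_ball (E := E) hp
  set A := (fockIntegral p α F).toReal
  refine ⟨(C₀ * A) ^ (1 / p), by positivity, fun z => ?_⟩
  -- `M` dominates the reciprocal of the Gaussian weight on the unit disc around `z`.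
  set M := Real.exp (α * (‖z‖ + 1) ^ 2 / 2) with hMdef
  have hM : 0 < M := Real.exp_pos _
  have h1 : ∫⁻ w in Metric.ball z 1, ENNReal.ofReal (‖F w‖ ^ p) ≤ ENNReal.ofReal (A * M ^ p) := by
    calc ∫⁻ w in Metric.ball z 1, ENNReal.ofReal (‖F w‖ ^ p)
        ≤ ∫⁻ w in Metric.ball z 1, ENNReal.ofReal (M ^ p) *
            ENNReal.ofReal (fockDensity p α F w) := by
          refine setLIntegral_mono' measurableSet_ball fun w hw => ?_
          rw [← ENNReal.ofReal_mul (by positivity)]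
          refine ENNReal.ofReal_le_ofReal ?_
          unfold fockDensity
          rw [mul_left_comm, ← Real.mul_rpow hM.le (Real.exp_pos _).le]
          refine le_mul_of_one_le_right (by positivity) (Real.one_le_rpow ?_ hp.le)
          rw [hMdef, ← Real.exp_add]
          refine Real.one_le_exp ?_
          have hw1 : ‖w‖ ≤ ‖z‖ + 1 := by
            have := mem_ball_iff_norm.1 hw
            have := norm_le_norm_add_norm_sub' w z
            linarith
          have : ‖w‖ ^ 2 ≤ (‖z‖ + 1) ^ 2 := by gcongr
          nlinarith
      _ ≤ ∫⁻ w, ENNReal.ofReal (M ^ p) * ENNReal.ofReal (fockDensity p α F w) :=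
          setLIntegral_le_lintegral _ _
      _ = ENNReal.ofReal (A * M ^ p) := by
          rw [lintegral_const_mul' _ _ ENNReal.ofReal_ne_top, mul_comm A,
            ENNReal.ofReal_mul (by positivity), ENNReal.ofReal_toReal hfin.ne]
          rfl
  have h2 : ‖F z‖ ^ p ≤ C₀ * (A * M ^ p) := by
    have := (h F hF z).trans (mul_le_mul_right h1 _)
    rw [← ENNReal.ofReal_mul hC₀] at this
    exact (ENNReal.ofReal_le_ofReal_iff (by positivity)).1 this
  calc ‖F z‖ = (‖F z‖ ^ p) ^ (1 / p) := by
        rw [← Real.rpow_mul (norm_nonneg _), mul_one_div_cancel hp.ne', Real.rpow_one]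
    _ ≤ (C₀ * (A * M ^ p)) ^ (1 / p) := Real.rpow_le_rpow (by positivity) h2 (by positivity)
    _ = (C₀ * A) ^ (1 / p) * M := by
        rw [← mul_assoc, Real.mul_rpow (by positivity) (by positivity), ← Real.rpow_mul hM.le,
          mul_one_div_cancel hp.ne', Real.rpow_one]

end Fock

/-! ### Dominated convergence and dilations -/

/-- A dominated convergence theorem with varying dominating functions `u n`, converging pointwise
and in mean to an integrable `U`. -/
lemma tendsto_lintegral_zero_of_le_of_tendsto {X : Type*} [MeasurableSpace X] {μ : Measure X}
    {u v : ℕ → X → ℝ≥0∞} {U : X → ℝ≥0∞} (hu : ∀ n, Measurable (u n)) (hv : ∀ n, Measurable (v n))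
    (hU : Measurable U) (hUfin : ∫⁻ x, U x ∂μ ≠ ∞) (hle : ∀ n x, v n x ≤ u n x)
    (hulim : ∀ x, Tendsto (fun n => u n x) atTop (𝓝 (U x)))
    (hvlim : ∀ x, Tendsto (fun n => v n x) atTop (𝓝 0))
    (hint : Tendsto (fun n => ∫⁻ x, u n x ∂μ) atTop (𝓝 (∫⁻ x, U x ∂μ))) :
    Tendsto (fun n => ∫⁻ x, v n x ∂μ) atTop (𝓝 0) := by
  -- Since `v ≤ u`, one has `v ≤ min v U + (u - U)` with truncated subtraction. Ordinary dominated
  -- convergence handles the first term; convergence of the integrals of `u n` handles the second.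
  have h1 : Tendsto (fun n => ∫⁻ x, min (v n x) (U x) ∂μ) atTop (𝓝 0) := by
    have := tendsto_lintegral_of_dominated_convergence (μ := μ) (f := fun _ => 0) U
      (fun n => (hv n).min hU) (fun n => Eventually.of_forall fun x => min_le_right _ _) hUfin
      (Eventually.of_forall fun x => by
        simpa using (hvlim x).min (tendsto_const_nhds (x := U x)))
    simpa using this
  have h2 : Tendsto (fun n => ∫⁻ x, min (u n x) (U x) ∂μ) atTop (𝓝 (∫⁻ x, U x ∂μ)) :=
    tendsto_lintegral_of_dominated_convergence (μ := μ) U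
      (fun n => (hu n).min hU) (fun n => Eventually.of_forall fun x => min_le_right _ _) hUfin
      (Eventually.of_forall fun x => by
        simpa using (hulim x).min (tendsto_const_nhds (x := U x)))
  have h3 : ∀ n, ∫⁻ x, (u n x - U x) ∂μ = ∫⁻ x, u n x ∂μ - ∫⁻ x, min (u n x) (U x) ∂μ := fun n => by
    refine ENNReal.eq_sub_of_add_eq
      (ne_top_of_le_ne_top hUfin (lintegral_mono fun x => min_le_right _ _)) ?_
    rw [← lintegral_add_right _ ((hu n).min hU)]
    refine lintegral_congr fun x => ?_
    rcases le_total (u n x) (U x) with h | h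
    · rw [tsub_eq_zero_of_le h, min_eq_left h, zero_add]
    · rw [min_eq_right h, tsub_add_cancel_of_le h]
  have h4 : Tendsto (fun n => ∫⁻ x, (u n x - U x) ∂μ) atTop (𝓝 0) := by
    simp_rw [h3]
    have := ENNReal.Tendsto.sub hint h2 (Or.inl hUfin)
    simpa using this
  have h5 := h1.add h4
  rw [add_zero] at h5
  refine tendsto_of_tendsto_of_tendsto_of_le_of_le tendsto_const_nhds h5
    (fun n => zero_le) fun n => ?_
  rw [← lintegral_add_left ((hv n).min hU)]
  refine lintegral_mono fun x => ?_
  rcases le_total (v n x) (U x) with h | h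
  · simp [min_eq_left h]
  · simp only [min_eq_right h]
    exact (hle n x).trans le_add_tsub

lemma lintegral_comp_smul_complex {g : ℂ → ℝ≥0∞} (hg : Measurable g) {r : ℝ} (hr : r ≠ 0) :
    ∫⁻ z : ℂ, g (r • z) = ENNReal.ofReal (r ^ 2)⁻¹ * ∫⁻ z : ℂ, g z := by
  rw [← lintegral_map hg (measurable_const_smul r),
    Measure.map_addHaar_smul volume hr, Complex.finrank_real_complex, lintegral_smul_measure,
    abs_of_nonneg (by positivity), smul_eq_mul]

section Fock

variable {E : Type*} [NormedAddCommGroup E]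

/-- The weight decreases in `‖z‖`. The right-hand side is a dilate of one fixed density, so its
integral is explicit. -/
lemma fockDensity_smul_le {p α r : ℝ} (hp : 0 < p) (hα : 0 < α) (hr0 : 0 ≤ r) (hr1 : r ≤ 1)
    (F : ℂ → E) (z : ℂ) :
    fockDensity p α (fun w => F (r • w)) z ≤ fockDensity p α F (r • z) := by
  unfold fockDensity
  refine mul_le_mul_of_nonneg_left (Real.rpow_le_rpow (Real.exp_pos _).le
    (Real.exp_le_exp.2 ?_) hp.le) (by positivity)
  rw [norm_smul, Real.norm_of_nonneg hr0]
  have : (r * ‖z‖) ^ 2 ≤ ‖z‖ ^ 2 := by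
    gcongr; exact mul_le_of_le_one_left (norm_nonneg _) hr1
  nlinarith

/-- Dilations are continuous at `1` in the Fock space. -/
lemma tendsto_fockIntegral_dilation_sub {p α : ℝ} (hp : 0 < p) (hα : 0 < α) {F : ℂ → E}
    (hF : Continuous F) (hfin : fockIntegral p α F < ∞) {r : ℕ → ℝ} (hr0 : ∀ n, 0 < r n)
    (hr1 : ∀ n, r n ≤ 1) (hr : Tendsto r atTop (𝓝 1)) :
    Tendsto (fun n => fockIntegral p α fun z => F (r n • z) - F z) atTop (𝓝 0) := by
  set g : ℂ → ℝ≥0∞ := fun z => ENNReal.ofReal (fockDensity p α F z) with hg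
  have hgcont : Continuous g :=
    ENNReal.continuous_ofReal.comp (continuous_fockDensity hp α hF)
  have hgm : Measurable g := hgcont.measurable
  have hgr : ∀ n, Measurable fun z => g (r n • z) := fun n =>
    hgm.comp (measurable_const_smul (r n))
  have hrz : ∀ z : ℂ, Tendsto (fun n => r n • z) atTop (𝓝 z) := fun z => by
    simpa using hr.smul_const z
  have hI : ∫⁻ z, g z ≠ ∞ := hfin.ne
  refine tendsto_lintegral_zero_of_le_of_tendsto
    (u := fun n z => ENNReal.ofReal (2 ^ p) * (g (r n • z) + g z))
    (U := fun z => ENNReal.ofReal (2 ^ p) * (g z + g z))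
    (fun n => ((hgr n).add hgm).const_mul _) (fun n => ?_) ((hgm.add hgm).const_mul _)
    ?_ (fun n z => ?_) (fun z => ?_) (fun z => ?_) ?_
  · exact (continuous_fockDensity hp α
      ((hF.comp (continuous_const_smul (r n))).sub hF)).measurable.ennreal_ofReal
  · rw [lintegral_const_mul' _ _ ENNReal.ofReal_ne_top, lintegral_add_left hgm]
    exact ENNReal.mul_ne_top ENNReal.ofReal_ne_top (ENNReal.add_ne_top.2 ⟨hI, hI⟩)
  · simp only [hg]
    rw [← ENNReal.ofReal_add (fockDensity_nonneg _ _ _ _) (fockDensity_nonneg _ _ _ _),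
      ← ENNReal.ofReal_mul (by positivity)]
    refine ENNReal.ofReal_le_ofReal ((fockDensity_le_of_norm_le_add hp α
      (F := fun w => F (r n • w)) (G := F) (norm_sub_le _ _)).trans ?_)
    gcongr
    exact fockDensity_smul_le hp hα (hr0 n).le (hr1 n) F z
  · exact ENNReal.Tendsto.const_mul (((hgcont.tendsto z).comp (hrz z)).add tendsto_const_nhds)
      (Or.inr ENNReal.ofReal_ne_top)
  · have h1 : Tendsto (fun n => ‖F (r n • z) - F z‖) atTop (𝓝 0) := by
      have := (((hF.tendsto z).comp (hrz z)).sub_const (F z)).norm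
      simpa using this
    have h2 : Tendsto (fun n => fockDensity p α (fun w => F (r n • w) - F w) z) atTop (𝓝 0) := by
      have := (h1.rpow_const (p := p) (Or.inr hp.le)).mul_const
        ((Real.exp (-α * ‖z‖ ^ 2 / 2)) ^ p)
      simpa [fockDensity, Real.zero_rpow hp.ne'] using this
    simpa using ENNReal.tendsto_ofReal h2
  · have h1 : ∀ n, ∫⁻ z, ENNReal.ofReal (2 ^ p) * (g (r n • z) + g z) =
        ENNReal.ofReal (2 ^ p) * (ENNReal.ofReal ((r n) ^ 2)⁻¹ * (∫⁻ z, g z) + ∫⁻ z, g z) :=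
      fun n => by
        rw [lintegral_const_mul' _ _ ENNReal.ofReal_ne_top, lintegral_add_left (hgr n),
          lintegral_comp_smul_complex hgm (hr0 n).ne']
    simp_rw [h1]
    rw [lintegral_const_mul' _ _ ENNReal.ofReal_ne_top, lintegral_add_left hgm]
    refine ENNReal.Tendsto.const_mul (Tendsto.add ?_ tendsto_const_nhds)
      (Or.inr ENNReal.ofReal_ne_top)
    have h2 : Tendsto (fun n => ENNReal.ofReal ((r n) ^ 2)⁻¹) atTop (𝓝 1) := by
      have : Tendsto (fun n => ((r n) ^ 2)⁻¹) atTop (𝓝 1) := by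
        simpa using (hr.pow 2).inv₀ (by norm_num)
      simpa using ENNReal.tendsto_ofReal this
    simpa using ENNReal.Tendsto.mul_const h2 (Or.inr hI)

lemma lintegral_gaussian_lt_top {b : ℝ} (hb : 0 < b) :
    ∫⁻ z : ℂ, ENNReal.ofReal (Real.exp (-b * ‖z‖ ^ 2)) < ∞ := by
  have h := GaussianFourier.integrable_cexp_neg_mul_sq_norm_add (V := ℂ) (b := (b : ℂ))
    (by simpa using hb) 0 0
  have h2 := h.norm.lintegral_lt_top
  refine lt_of_eq_of_lt (lintegral_congr fun z => ?_) h2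
  rw [Complex.norm_exp]
  congr 2
  simp [← Complex.ofReal_pow]

/-! ### Taylor polynomials of dilations -/

variable [NormedSpace ℂ E] [CompleteSpace E]

/-- Cauchy's estimate for the coefficients of an entire power series. -/
lemma norm_coeff_mul_pow_le {F : ℂ → E} (hF : Differentiable ℂ F) {R C : ℝ} (hR : 0 ≤ R)
    (hC : ∀ z, ‖z‖ = R → ‖F z‖ ≤ C) (k : ℕ) :
    ‖((k.factorial : ℂ)⁻¹ • iteratedDeriv k F 0)‖ * R ^ k ≤ C := by
  have hC0 : 0 ≤ C := (norm_nonneg _).trans (hC (R : ℂ) (by simpa using hR))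
  -- Radius zero is needed because the estimate is later used with `R = s * ‖z‖` at `z = 0`.
  rcases hR.eq_or_lt with rfl | hR
  · rcases k with _ | k
    · simpa using hC 0 (by simp)
    · simpa using hC0
  have := Complex.norm_iteratedDeriv_le_of_forall_mem_sphere_norm_le k hR
    hF.diffContOnCl (c := 0) (C := C) fun z hz => hC z (by simpa using hz)
  rw [le_div_iff₀ (by positivity)] at this
  rw [norm_smul, norm_inv, Complex.norm_natCast, mul_assoc, inv_mul_le_iff₀ (by positivity)]
  exact this

/-- The Taylor polynomials of a proper dilation of `F` converge to it in the Fock space. -/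
lemma tendsto_fockIntegral_taylor_dilation {p α s : ℝ} (hp : 0 < p) (hα : 0 < α)
    (hs0 : 0 < s) (hs1 : s < 1) {F : ℂ → E} (hF : Differentiable ℂ F)
    (hfin : fockIntegral p α F < ∞) :
    Tendsto (fun N : ℕ => fockIntegral p α fun z =>
      (∑ k ∈ Finset.range N, ((s ^ 2) • z) ^ k • ((k.factorial : ℂ)⁻¹ • iteratedDeriv k F 0)) -
        F ((s ^ 2) • z)) atTop (𝓝 0) := by
  obtain ⟨C, hC0, hC⟩ := exists_norm_le_of_fockIntegral_lt_top hp hα hF hfin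
  set a : ℕ → E := fun k => (k.factorial : ℂ)⁻¹ • iteratedDeriv k F 0 with ha
  set B : ℂ → ℝ := fun z => C * Real.exp (α * (s * ‖z‖ + 1) ^ 2 / 2) with hB
  have hsum : ∀ z, HasSum (fun k => z ^ k • a k) (F z) := fun z => by
    have := Complex.hasSum_taylorSeries_of_entire hF 0 z
    simp only [sub_zero] at this
    simpa only [ha, smul_comm (_ ^ _ : ℂ)] using this
  -- One factor `s` of the dilation `s ^ 2` goes into the Cauchy radius `s * ‖z‖`; the other yields
  -- geometric decay.
  have hterm : ∀ z k, ‖((s ^ 2) • z) ^ k • a k‖ ≤ B z * s ^ k := fun z k => by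
    have h1 := norm_coeff_mul_pow_le hF (R := s * ‖z‖) (C := B z) (by positivity)
      (fun w hw => by simpa only [hw, hB] using hC w) k
    calc ‖((s ^ 2) • z) ^ k • a k‖ = ‖a k‖ * (s * ‖z‖) ^ k * s ^ k := by
          rw [norm_smul, norm_pow, norm_smul, Real.norm_of_nonneg (by positivity)]; ring
      _ ≤ B z * s ^ k := by gcongr
  have hgeom := hasSum_geometric_of_lt_one hs0.le hs1
  have htail : ∀ N z, ‖(∑ k ∈ Finset.range N, ((s ^ 2) • z) ^ k • a k) - F ((s ^ 2) • z)‖ ≤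
      s ^ N * (B z * (1 - s)⁻¹) := fun N z => by
    have h1 := (hasSum_nat_add_iff' N).2 (hsum ((s ^ 2) • z))
    rw [norm_sub_rev, ← h1.tsum_eq]
    refine tsum_of_norm_bounded (g := fun k => s ^ N * (B z * s ^ k)) ?_ fun k => ?_
    · exact (hgeom.mul_left (B z)).mul_left _
    · refine (hterm z (k + N)).trans (le_of_eq ?_); rw [pow_add]; ring
  set D : ℝ := (C * Real.exp (α / (2 * (1 - s))) * (1 - s)⁻¹) ^ p with hD
  have h1s : 0 < 1 - s := by linarith
  have hD0 : 0 ≤ D := by positivity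
  set b : ℝ := p * α * (1 - s) / 2 with hb
  have hb0 : 0 < b := by positivity
  have hdens : ∀ N z, fockDensity p α (fun z =>
      (∑ k ∈ Finset.range N, ((s ^ 2) • z) ^ k • a k) - F ((s ^ 2) • z)) z ≤
      (s ^ p) ^ N * D * Real.exp (-b * ‖z‖ ^ 2) := fun N z => by
    unfold fockDensity
    rw [← Real.mul_rpow (norm_nonneg _) (Real.exp_pos _).le]
    have h2 : Real.exp (α * (s * ‖z‖ + 1) ^ 2 / 2) * Real.exp (-α * ‖z‖ ^ 2 / 2) ≤
        Real.exp (α / (2 * (1 - s))) * Real.exp (-(α * (1 - s) / 2) * ‖z‖ ^ 2) := by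
      rw [← Real.exp_add, ← Real.exp_add, Real.exp_le_exp]
      -- Convexity of the square with weights `s` and `1 - s`, at the points `‖z‖` and `1 / (1 -
      -- s)`.
      have h3 : (s * ‖z‖ + 1) ^ 2 ≤ s * ‖z‖ ^ 2 + 1 / (1 - s) := by
        have h4 : s * ‖z‖ ^ 2 + 1 / (1 - s) - (s * ‖z‖ + 1) ^ 2 =
            s * ((1 - s) * ‖z‖ - 1) ^ 2 / (1 - s) := by field_simp; ring
        have : 0 ≤ s * ((1 - s) * ‖z‖ - 1) ^ 2 / (1 - s) := by positivity
        linarith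
      have h5 : α / (2 * (1 - s)) = α / 2 * (1 / (1 - s)) := by field_simp
      rw [h5]
      nlinarith
    calc (‖(∑ k ∈ Finset.range N, ((s ^ 2) • z) ^ k • a k) - F ((s ^ 2) • z)‖ *
          Real.exp (-α * ‖z‖ ^ 2 / 2)) ^ p
        ≤ (s ^ N * (C * Real.exp (α / (2 * (1 - s))) * (1 - s)⁻¹) *
            Real.exp (-(α * (1 - s) / 2) * ‖z‖ ^ 2)) ^ p := by
          refine Real.rpow_le_rpow (by positivity) ?_ hp.le
          calc _ ≤ s ^ N * (B z * (1 - s)⁻¹) * Real.exp (-α * ‖z‖ ^ 2 / 2) := by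
                gcongr; exact htail N z
            _ = s ^ N * C * (1 - s)⁻¹ * (Real.exp (α * (s * ‖z‖ + 1) ^ 2 / 2) *
                Real.exp (-α * ‖z‖ ^ 2 / 2)) := by simp only [hB]; ring
            _ ≤ s ^ N * C * (1 - s)⁻¹ * (Real.exp (α / (2 * (1 - s))) *
                Real.exp (-(α * (1 - s) / 2) * ‖z‖ ^ 2)) := by gcongr
            _ = _ := by ring
      _ = (s ^ p) ^ N * D * Real.exp (-b * ‖z‖ ^ 2) := by
          rw [Real.mul_rpow (by positivity) (by positivity),
            Real.mul_rpow (by positivity) (by positivity), ← Real.exp_mul,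
            ← Real.rpow_natCast_mul hs0.le, ← Real.rpow_mul_natCast hs0.le, mul_comm p, hD, hb]
          congr 2; ring
  have hG := lintegral_gaussian_lt_top hb0
  set G := ∫⁻ z : ℂ, ENNReal.ofReal (Real.exp (-b * ‖z‖ ^ 2))
  have hlim : Tendsto (fun N : ℕ => ENNReal.ofReal ((s ^ p) ^ N * D) * G) atTop (𝓝 0) := by
    have h1 : Tendsto (fun N : ℕ => (s ^ p) ^ N * D) atTop (𝓝 0) := by
      simpa using (tendsto_pow_atTop_nhds_zero_of_lt_one (by positivity)
        (Real.rpow_lt_one hs0.le hs1 hp)).mul_const D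
    simpa using ENNReal.Tendsto.mul_const (ENNReal.tendsto_ofReal h1) (Or.inr hG.ne)
  refine tendsto_of_tendsto_of_tendsto_of_le_of_le tendsto_const_nhds hlim
    (fun n => zero_le) fun N => ?_
  unfold fockIntegral
  rw [← lintegral_const_mul' _ _ ENNReal.ofReal_ne_top]
  refine lintegral_mono fun z => ?_
  rw [← ENNReal.ofReal_mul (by positivity)]
  exact ENNReal.ofReal_le_ofReal (hdens N z)

/-- Polynomials of the form `∑ k < N, (r z) ^ k a_k`, where the `a_k` are the Taylor coefficients of
`F`, approximate `F` in the Fock space. -/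
theorem exists_fockIntegral_taylor_sub_le {p α : ℝ} (hp : 0 < p) (hα : 0 < α) {F : ℂ → E}
    (hF : Differentiable ℂ F) (hfin : fockIntegral p α F < ∞) {ε : ℝ≥0∞} (hε : 0 < ε) :
    ∃ (r : ℝ) (N : ℕ), fockIntegral p α (fun z =>
      (∑ k ∈ Finset.range N, (r • z) ^ k • ((k.factorial : ℂ)⁻¹ • iteratedDeriv k F 0)) - F z)
        ≤ ε := by
  -- Two errors of size `δ`, times the quasi-triangle constant `2 ^ p`, add up to at most `ε`.
  set δ : ℝ≥0∞ := ε / (2 * ENNReal.ofReal (2 ^ p)) with hδ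
  have hδ0 : 0 < δ := ENNReal.div_pos hε.ne' (ENNReal.mul_ne_top (by simp) ENNReal.ofReal_ne_top)
  set s : ℕ → ℝ := fun n => 1 - 1 / ((n : ℝ) + 2) with hs
  have hs0 : ∀ n, 0 < s n := fun n => by
    have : 1 / ((n : ℝ) + 2) < 1 := by
      rw [div_lt_one (by positivity)]; linarith [n.cast_nonneg (α := ℝ)]
    simp only [hs]; linarith
  have hs1 : ∀ n, s n < 1 := fun n => by
    have : 0 < 1 / ((n : ℝ) + 2) := by positivity
    simp only [hs]; linarith
  have hslim : Tendsto s atTop (𝓝 1) := by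
    have h : Tendsto (fun n : ℕ => 1 / ((n : ℝ) + 2)) atTop (𝓝 0) := by
      have := (tendsto_one_div_add_atTop_nhds_zero_nat (𝕜 := ℝ)).comp (tendsto_add_atTop_nat 1)
      refine this.congr fun n => ?_
      simp only [Function.comp_apply]; push_cast; congr 1; ring
    simpa [hs] using h.const_sub 1
  have h1 := tendsto_fockIntegral_dilation_sub hp hα hF.continuous hfin (r := fun n => s n ^ 2)
    (fun n => pow_pos (hs0 n) 2) (fun n => pow_le_one₀ (hs0 n).le (hs1 n).le)
    (by simpa using hslim.pow 2)
  obtain ⟨n, hn⟩ := (h1.eventually_lt_const hδ0).exists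
  obtain ⟨N, hN⟩ := ((tendsto_fockIntegral_taylor_dilation hp hα (hs0 n) (hs1 n) hF
    hfin).eventually_lt_const hδ0).exists
  refine ⟨s n ^ 2, N, ?_⟩
  refine (fockIntegral_le_of_norm_le_add hp α (F := fun z => (∑ k ∈ Finset.range N,
    ((s n ^ 2) • z) ^ k • ((k.factorial : ℂ)⁻¹ • iteratedDeriv k F 0)) - F ((s n ^ 2) • z))
    (G := fun z => F ((s n ^ 2) • z) - F z) ?_ fun z => ?_).trans ?_
  · have := hF.continuous
    fun_prop
  · exact norm_sub_le_norm_sub_add_norm_sub _ _ _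
  · calc _ ≤ ENNReal.ofReal (2 ^ p) * (δ + δ) := by gcongr
      _ = 2 * ENNReal.ofReal (2 ^ p) * (ε / (2 * ENNReal.ofReal (2 ^ p))) := by
        rw [← two_mul, hδ]; ring
      _ ≤ ε := ENNReal.mul_div_le

end Fock

/-! ### Slices as complex structures on `ℍ` -/

lemma mul_self_of_mem_imagUnits {I : ℍ[ℝ]} (hI : I ∈ imagUnits) : I * I = -1 := by
  obtain ⟨h0, h1⟩ := hI
  ext <;> simp [h0] <;> linarith

lemma norm_of_mem_imagUnits {I : ℍ[ℝ]} (hI : I ∈ imagUnits) : ‖I‖ = 1 := by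
  have h := congrArg norm (mul_self_of_mem_imagUnits hI)
  rw [norm_mul, norm_neg, norm_one] at h
  nlinarith [norm_nonneg I]

lemma slicePt_eq_liftAux {I : ℍ[ℝ]} (hI : I ∈ imagUnits) (z : ℂ) :
    slicePt I z = Complex.liftAux I (mul_self_of_mem_imagUnits hI) z := by
  rw [Complex.liftAux_apply, slicePt, ← Quaternion.coe_commutes, Quaternion.coe_mul_eq_smul]
  rfl

lemma slicePt_pow {I : ℍ[ℝ]} (hI : I ∈ imagUnits) (z : ℂ) (k : ℕ) :
    slicePt I (z ^ k) = slicePt I z ^ k := by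
  simp only [slicePt_eq_liftAux hI, map_pow]

lemma slicePt_ofReal (I : ℍ[ℝ]) (x : ℝ) : slicePt I x = x := by
  simp [slicePt]

lemma norm_slicePt {I : ℍ[ℝ]} (hI : I ∈ imagUnits) (z : ℂ) : ‖slicePt I z‖ = ‖z‖ := by
  obtain ⟨h0, h1⟩ := hI
  have h : Quaternion.normSq (slicePt I z) = Complex.normSq z := by
    rw [Quaternion.normSq_def', Complex.normSq_apply]
    simp [slicePt, h0]
    linear_combination z.im ^ 2 * h1
  rw [Quaternion.normSq_eq_norm_mul_self, Complex.normSq_eq_norm_sq, sq] at h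
  exact (mul_self_inj_of_nonneg (norm_nonneg _) (norm_nonneg _)).1 h

/-- The complex structure on `ℍ` given by left multiplication with elements of `ℂ_I`. -/
noncomputable abbrev sliceNormedSpace (I : ℍ[ℝ]) (hI : I ∈ imagUnits) : NormedSpace ℂ ℍ[ℝ] :=
  { Module.compHom ℍ[ℝ] (Complex.liftAux I (mul_self_of_mem_imagUnits hI)).toRingHom with
    norm_smul_le := fun z q => by
      change ‖Complex.liftAux I (mul_self_of_mem_imagUnits hI) z * q‖ ≤ _
      rw [← slicePt_eq_liftAux hI, norm_mul, norm_slicePt hI] }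

lemma sliceNormedSpace_smul {I : ℍ[ℝ]} (hI : I ∈ imagUnits) (z : ℂ) (q : ℍ[ℝ]) :
    (letI := sliceNormedSpace I hI; z • q) = slicePt I z * q := by
  rw [slicePt_eq_liftAux hI]; rfl

/-- `slicePt I` as a real-linear map. -/
noncomputable def slicePtCLM (I : ℍ[ℝ]) : ℂ →L[ℝ] ℍ[ℝ] :=
  LinearMap.toContinuousLinearMap
    { toFun := slicePt I
      map_add' := fun z w => by simp [slicePt, mul_add]; abel
      map_smul' := fun r z => by
        simp only [slicePt, Complex.smul_re, Complex.smul_im, smul_eq_mul, Quaternion.coe_mul,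
          RingHom.id_apply, smul_add, ← Quaternion.coe_mul_eq_smul]
        rw [← mul_assoc I, ← Quaternion.coe_commutes r I, mul_assoc] }

lemma continuous_slicePt (I : ℍ[ℝ]) : Continuous (slicePt I) := (slicePtCLM I).continuous

/-- The restriction of a slice regular function to a slice is holomorphic. -/
lemma IsEntireSliceRegular.differentiable_slice {f : ℍ[ℝ] → ℍ[ℝ]} (hf : IsEntireSliceRegular f)
    {I : ℍ[ℝ]} (hI : I ∈ imagUnits) :
    letI := sliceNormedSpace I hI
    Differentiable ℂ fun z => f (slicePt I z) := by
  intro z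
  set L : ℂ →L[ℝ] ℍ[ℝ] := (fderiv ℝ f (slicePt I z)).comp (slicePtCLM I) with hL
  have hd : HasFDerivAt (fun z => f (slicePt I z)) L z :=
    (hf.differentiable (slicePt I z)).hasFDerivAt.comp z (slicePtCLM I).hasFDerivAt
  have hx : HasDerivAt (fun s : ℝ => f (slicePt I ⟨s, z.im⟩)) (L 1) z.re := by
    have h : HasDerivAt (fun s : ℝ => (⟨s, z.im⟩ : ℂ)) 1 z.re := by
      have := (Complex.ofRealCLM.hasDerivAt (x := z.re)).add_const (z.im * Complex.I)
      simpa [Complex.mk_eq_add_mul_I] using this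
    exact HasFDerivAt.comp_hasDerivAt z.re (f := fun s : ℝ => (⟨s, z.im⟩ : ℂ)) hd h
  have hy : HasDerivAt (fun t : ℝ => f (slicePt I ⟨z.re, t⟩)) (L Complex.I) z.im := by
    have h : HasDerivAt (fun t : ℝ => (⟨z.re, t⟩ : ℂ)) Complex.I z.im := by
      have := ((Complex.ofRealCLM.hasDerivAt (x := z.im)).mul_const Complex.I).const_add (z.re : ℂ)
      simpa [Complex.mk_eq_add_mul_I] using this
    exact HasFDerivAt.comp_hasDerivAt z.im (f := fun t : ℝ => (⟨z.re, t⟩ : ℂ)) hd h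
  have hcr : L Complex.I = I * L 1 := by
    have h := hf.dbar_eq_zero I hI z.re z.im
    rw [sliceDbar, hx.deriv, hy.deriv, smul_eq_zero] at h
    have h2 := h.resolve_left (by norm_num)
    have h3 : I * (L 1 + I * L Complex.I) = 0 := by rw [h2, mul_zero]
    rw [mul_add, ← mul_assoc, mul_self_of_mem_imagUnits hI, neg_one_mul] at h3
    exact (add_neg_eq_zero.1 h3).symm
  -- The Cauchy–Riemann relation makes the real derivative complex linear for left multiplication by
  -- `ℂ_I`.
  have hlin : ∀ w : ℂ, L w = slicePt I w * L 1 := fun w => by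
    conv_lhs => rw [← Complex.re_add_im w]
    have h1 : ((w.re : ℂ) + w.im * Complex.I) = w.re • (1 : ℂ) + w.im • Complex.I := by
      simp
    rw [h1, map_add, map_smul, map_smul, hcr, slicePt, add_mul, Quaternion.coe_mul_eq_smul,
      ← Quaternion.coe_commutes, mul_assoc, Quaternion.coe_mul_eq_smul]
  let := sliceNormedSpace I hI
  refine HasDerivAt.differentiableAt (f' := L 1) ?_
  rw [hasDerivAt_iff_isLittleO]
  rw [hasFDerivAt_iff_isLittleO] at hd
  refine hd.congr_left fun w => ?_
  rw [hlin, ← sliceNormedSpace_smul hI]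

/-- A slice regular function has a power series on each slice; in the Fock space, polynomials built
from its coefficients approximate it on that slice. -/
lemma IsEntireSliceRegular.exists_hasSum_slice {f : ℍ[ℝ] → ℍ[ℝ]} (hf : IsEntireSliceRegular f)
    {I : ℍ[ℝ]} (hI : I ∈ imagUnits) :
    ∃ a : ℕ → ℍ[ℝ], (∀ z, HasSum (fun k => slicePt I z ^ k * a k) (f (slicePt I z))) ∧
      ∀ p α : ℝ, 0 < p → 0 < α → fockIntegral p α (fun z => f (slicePt I z)) < ∞ →
        ∀ ε : ℝ≥0∞, 0 < ε → ∃ (r : ℝ) (N : ℕ), fockIntegral p α (fun z =>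
          (∑ k ∈ Finset.range N, slicePt I z ^ k * (r ^ k • a k)) - f (slicePt I z)) ≤ ε := by
  have hd := hf.differentiable_slice hI
  let := sliceNormedSpace I hI
  refine ⟨fun k => (k.factorial : ℂ)⁻¹ • iteratedDeriv k (fun z => f (slicePt I z)) 0,
    fun z => ?_, fun p α hp hα hfin ε hε => ?_⟩
  · have h := Complex.hasSum_taylorSeries_of_entire hd 0 z
    convert! h using 2 with k
    rw [sub_zero, smul_comm, sliceNormedSpace_smul hI (z ^ k), slicePt_pow hI]
  · obtain ⟨r, N, h⟩ := exists_fockIntegral_taylor_sub_le hp hα hd hfin hε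
    refine ⟨r, N, le_of_eq_of_le ?_ h⟩
    congr 1
    funext z
    congr 1
    refine Finset.sum_congr rfl fun k _ => ?_
    -- Being real, `r` is central, so `r ^ k` can be absorbed into the right coefficient.
    rw [sliceNormedSpace_smul hI ((r • z) ^ k), slicePt_pow hI,
      show slicePt I (r • z) = r • slicePt I z from (slicePtCLM I).map_smul r z,
      smul_pow, mul_smul_comm, smul_mul_assoc]

/-! ### Passing from one slice to all of `ℍ` -/

/-- Power series in a real variable with equal sums have equal coefficients. -/
lemma coeff_eq_of_hasSum_real {V : Type*} [NormedAddCommGroup V] [NormedSpace ℝ V]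
    {a b : ℕ → V} {g : ℝ → V} (ha : ∀ x : ℝ, HasSum (fun k => x ^ k • a k) (g x))
    (hb : ∀ x : ℝ, HasSum (fun k => x ^ k • b k) (g x)) : a = b := by
  have key : ∀ c : ℕ → V, (∀ x : ℝ, HasSum (fun k => x ^ k • c k) (g x)) →
      HasFPowerSeriesAt g (fun n => ContinuousMultilinearMap.mkPiRing ℝ (Fin n) (c n)) 0 :=
    fun c hc => by
      refine hasFPowerSeriesAt_iff.2 (Eventually.of_forall fun x => ?_)
      simpa [FormalMultilinearSeries.coeff] using hc x
  have h := (key a ha).eq_formalMultilinearSeries (key b hb)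
  funext n
  have := congrArg (fun q => FormalMultilinearSeries.coeff q n) h
  simpa [FormalMultilinearSeries.coeff] using this

lemma exists_slicePt_eq (q : ℍ[ℝ]) : ∃ I ∈ imagUnits, ∃ z : ℂ, slicePt I z = q := by
  by_cases h : q.im = 0
  · refine ⟨(Complex.I : ℂ), by simp [imagUnits], (q.re : ℂ), ?_⟩
    rw [slicePt_ofReal]
    conv_rhs => rw [← Quaternion.re_add_im q, h, add_zero]
  · have hn : ‖q.im‖ ≠ 0 := norm_ne_zero_iff.2 h
    have hsq : q.imI ^ 2 + q.imJ ^ 2 + q.imK ^ 2 = ‖q.im‖ ^ 2 := by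
      rw [sq ‖q.im‖, ← Quaternion.normSq_eq_norm_mul_self, Quaternion.normSq_def']; simp
    refine ⟨(‖q.im‖⁻¹) • q.im, ⟨by simp, ?_⟩, ⟨q.re, ‖q.im‖⟩, ?_⟩
    · simp only [Quaternion.imI_smul, Quaternion.imJ_smul, Quaternion.imK_smul, Quaternion.imI_im,
        Quaternion.imJ_im, Quaternion.imK_im, smul_eq_mul, mul_pow]
      rw [← mul_add, ← mul_add, hsq, ← mul_pow, inv_mul_cancel₀ hn, one_pow]
    · rw [slicePt, ← Quaternion.coe_commutes, Quaternion.coe_mul_eq_smul, smul_smul,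
        mul_inv_cancel₀ hn, one_smul, Quaternion.re_add_im]

/-- The power series of a slice regular function on one slice represents it on all of `ℍ`. -/
lemma IsEntireSliceRegular.hasSum_of_slice {f : ℍ[ℝ] → ℍ[ℝ]} (hf : IsEntireSliceRegular f)
    {I : ℍ[ℝ]} {a : ℕ → ℍ[ℝ]}
    (ha : ∀ z, HasSum (fun k => slicePt I z ^ k * a k) (f (slicePt I z))) (q : ℍ[ℝ]) :
    HasSum (fun k => q ^ k * a k) (f q) := by
  obtain ⟨J, hJ, z, rfl⟩ := exists_slicePt_eq q
  obtain ⟨b, hb, -⟩ := hf.exists_hasSum_slice hJ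
  -- Restricted to the common real axis, the expansions on both slices are real power series of the
  -- same function.
  have key : ∀ (K : ℍ[ℝ]) (c : ℕ → ℍ[ℝ]),
      (∀ z, HasSum (fun k => slicePt K z ^ k * c k) (f (slicePt K z))) →
      ∀ x : ℝ, HasSum (fun k => x ^ k • c k) (f x) := fun K c hc x => by
    have h := hc x
    simpa only [slicePt_ofReal, ← Quaternion.coe_pow, Quaternion.coe_mul_eq_smul] using h
  rw [coeff_eq_of_hasSum_real (key I a ha) (key J b hb)]
  exact hb z

/-- The representation formula for power series bounds the values on one slice by those on
another one. -/
lemma norm_slicePt_le_of_hasSum {g : ℍ[ℝ] → ℍ[ℝ]} {c : ℕ → ℍ[ℝ]}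
    (hg : ∀ q, HasSum (fun k => q ^ k * c k) (g q)) {I J : ℍ[ℝ]} (hI : I ∈ imagUnits)
    (hJ : J ∈ imagUnits) (z : ℂ) :
    ‖g (slicePt J z)‖ ≤ ‖g (slicePt I z)‖ + ‖g (slicePt I (starRingEnd ℂ z))‖ := by
  -- Applied to `w = z ^ k`, this extends termwise to the series, as the constants act on the left
  -- and the coefficients on the right.
  have hrep : ∀ w : ℂ, slicePt J w = ((1 / 2 : ℝ) • (1 - J * I)) * slicePt I w +
      ((1 / 2 : ℝ) • (1 + J * I)) * slicePt I (starRingEnd ℂ w) := fun w => by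
    have h : J * I * (I * (w.im : ℍ[ℝ])) = -(J * w.im) := by
      rw [mul_assoc, ← mul_assoc I, mul_self_of_mem_imagUnits hI]; simp
    simp only [slicePt, Complex.conj_re, Complex.conj_im, Quaternion.coe_neg, mul_neg,
      smul_mul_assoc, ← smul_add, add_mul, sub_mul, mul_add, one_mul, h]
    module
  have h1 := ((hg (slicePt I z)).mul_left ((1 / 2 : ℝ) • (1 - J * I))).add
    ((hg (slicePt I (starRingEnd ℂ z))).mul_left ((1 / 2 : ℝ) • (1 + J * I)))
  have h2 : g (slicePt J z) = ((1 / 2 : ℝ) • (1 - J * I)) * g (slicePt I z) +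
      ((1 / 2 : ℝ) • (1 + J * I)) * g (slicePt I (starRingEnd ℂ z)) := by
    refine (hg (slicePt J z)).unique (h1.congr_fun ?_)
    intro k
    rw [← slicePt_pow hI, ← slicePt_pow hI, ← slicePt_pow hJ, hrep, map_pow, add_mul, mul_assoc,
      mul_assoc]
  have hJI : ‖J * I‖ = 1 := by
    rw [norm_mul, norm_of_mem_imagUnits hI, norm_of_mem_imagUnits hJ, one_mul]
  have hb1 : ‖(1 / 2 : ℝ) • (1 - J * I)‖ ≤ 1 := by
    have := norm_sub_le 1 (J * I)
    rw [norm_smul, Real.norm_of_nonneg (by norm_num)]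
    rw [norm_one, hJI] at this
    linarith
  have hb2 : ‖(1 / 2 : ℝ) • (1 + J * I)‖ ≤ 1 := by
    have := norm_add_le 1 (J * I)
    rw [norm_smul, Real.norm_of_nonneg (by norm_num)]
    rw [norm_one, hJI] at this
    linarith
  rw [h2]
  refine (norm_add_le _ _).trans (add_le_add ?_ ?_)
  · rw [norm_mul]; exact mul_le_of_le_one_left (norm_nonneg _) hb1
  · rw [norm_mul]; exact mul_le_of_le_one_left (norm_nonneg _) hb2

lemma sliceNorm_eq (p α : ℝ) {I : ℍ[ℝ]} (hI : I ∈ imagUnits) (g : ℍ[ℝ] → ℍ[ℝ]) :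
    sliceNorm p α I g = (ENNReal.ofReal (α * p / (2 * Real.pi)) *
      fockIntegral p α fun z => g (slicePt I z)) ^ (1 / p) := by
  simp only [sliceNorm, norm_slicePt hI, fockIntegral, fockDensity]

lemma fockIntegral_conj (p α : ℝ) (F : ℂ → ℍ[ℝ]) :
    fockIntegral p α (fun z => F (starRingEnd ℂ z)) = fockIntegral p α F := by
  have h := Complex.conjLIE.measurePreserving.lintegral_comp_emb
    Complex.conjLIE.toHomeomorph.measurableEmbedding
    (fun z => ENNReal.ofReal (fockDensity p α F z))
  rw [fockIntegral, fockIntegral, ← h]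
  simp [fockDensity]

/-- The representation formula gives two terms; conjugation preserves area and weight, so both have
the same integral. -/
lemma fockIntegral_slice_le {p : ℝ} (hp : 0 < p) (α : ℝ) {g : ℍ[ℝ] → ℍ[ℝ]} (hcont : Continuous g)
    {c : ℕ → ℍ[ℝ]} (hg : ∀ q, HasSum (fun k => q ^ k * c k) (g q)) {I J : ℍ[ℝ]}
    (hI : I ∈ imagUnits) (hJ : J ∈ imagUnits) :
    fockIntegral p α (fun z => g (slicePt J z)) ≤
      ENNReal.ofReal (2 ^ p) * (2 * fockIntegral p α fun z => g (slicePt I z)) := by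
  have h := fockIntegral_le_of_norm_le_add hp α (F := fun z => g (slicePt I z))
    (G := fun z => g (slicePt I (starRingEnd ℂ z))) (H := fun z => g (slicePt J z))
    (hcont.comp (continuous_slicePt I)) (norm_slicePt_le_of_hasSum hg hI hJ)
  rwa [fockIntegral_conj p α (fun z => g (slicePt I z)), ← two_mul] at h

lemma rightEval_sum_monomial (N : ℕ) (b : ℕ → ℍ[ℝ]) (q : ℍ[ℝ]) :
    rightEval (∑ k ∈ Finset.range N, Polynomial.monomial k (b k)) q =
      ∑ k ∈ Finset.range N, q ^ k * b k := by
  induction N with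
  | zero => simp [rightEval]
  | succ N ih =>
    rw [Finset.sum_range_succ, Finset.sum_range_succ, ← ih]
    unfold rightEval
    rw [Polynomial.sum_add_index _ _ _ (fun _ => mul_zero _) (fun _ _ _ => mul_add _ _ _),
      Polynomial.sum_monomial_index (b N) (fun k a => q ^ k * a) (mul_zero _)]

end SliceFock

theorem theorem4p4 (p α : ℝ) (hp : 0 < p) (hα : 0 < α)
    (f : ℍ[ℝ] → ℍ[ℝ]) (hf : f ∈ SliceFock.fockSecondKind α p) :
    ∃ P : ℕ → Polynomial ℍ[ℝ], ∀ I ∈ SliceFock.imagUnits,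
      Tendsto (fun n => SliceFock.sliceNorm p α I (fun q => SliceFock.rightEval (P n) q - f q))
        atTop (𝓝 0) := by
  open SliceFock in
  obtain ⟨hreg, I, hI, -, hnorm⟩ := hf
  have hfin : fockIntegral p α (fun z => f (slicePt I z)) < ∞ := by
    rw [sliceNorm_eq p α hI, ENNReal.rpow_lt_top_iff_of_pos (by positivity)] at hnorm
    refine ENNReal.lt_top_of_mul_ne_top_right hnorm.ne ?_
    simp only [ne_eq, ENNReal.ofReal_eq_zero, not_le]
    positivity
  obtain ⟨a, ha, happrox⟩ := hreg.exists_hasSum_slice hI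
  -- At `n = 0` the tolerance is `∞`, which is harmless.
  have hε : ∀ n : ℕ, (0 : ℝ≥0∞) < ((n : ℝ≥0∞))⁻¹ := fun n => by simp
  choose r N hrN using fun n : ℕ => happrox p α hp hα hfin _ (hε n)
  -- The polynomials are fixed by the slice `I` before `J` is introduced.
  refine ⟨fun n => ∑ k ∈ Finset.range (N n), Polynomial.monomial k (r n ^ k • a k), fun J hJ => ?_⟩
  have hbound : ∀ n, fockIntegral p α (fun z =>
      rightEval (∑ k ∈ Finset.range (N n), Polynomial.monomial k (r n ^ k • a k)) (slicePt J z) -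
        f (slicePt J z)) ≤ ENNReal.ofReal (2 ^ p) * (2 * ((n : ℝ≥0∞))⁻¹) := fun n => by
    simp only [rightEval_sum_monomial]
    refine (fockIntegral_slice_le hp α (I := I) (J := J)
      (g := fun q => ∑ k ∈ Finset.range (N n), q ^ k * (r n ^ k • a k) - f q)
      -- The error itself needs a global power series, so the polynomial's coefficients are padded
      -- with zeros.
      (c := fun k => (if k ∈ Finset.range (N n) then r n ^ k • a k else 0) - a k)
      ?_ (fun q => ?_) hI hJ).trans ?_
    · have := hreg.differentiable.continuous
      fun_prop
    · have h1 : HasSum (fun k => q ^ k * (if k ∈ Finset.range (N n) then r n ^ k • a k else 0))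
          (∑ k ∈ Finset.range (N n), q ^ k * (r n ^ k • a k)) := by
        have h2 := hasSum_sum_of_ne_finset_zero (L := SummationFilter.unconditional ℕ)
          (f := fun k =>
          q ^ k * (if k ∈ Finset.range (N n) then r n ^ k • a k else 0)) (s := Finset.range (N n))
          fun k hk => by simp only [if_neg hk, mul_zero]
        convert! h2 using 1
        exact Finset.sum_congr rfl fun k hk => by rw [if_pos hk]
      simpa only [mul_sub] using h1.sub (hreg.hasSum_of_slice ha q)
    · gcongr
      exact hrN n
  have hlim : Tendsto (fun n : ℕ => ENNReal.ofReal (α * p / (2 * Real.pi)) *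
      (ENNReal.ofReal (2 ^ p) * (2 * ((n : ℝ≥0∞))⁻¹))) atTop (𝓝 0) := by
    have h := ENNReal.Tendsto.const_mul (a := ENNReal.ofReal (α * p / (2 * Real.pi)))
      (ENNReal.Tendsto.const_mul (a := ENNReal.ofReal (2 ^ p))
      (ENNReal.Tendsto.const_mul (a := 2) ENNReal.tendsto_inv_nat_nhds_zero
        (Or.inr (by simp))) (Or.inr ENNReal.ofReal_ne_top)) (Or.inr ENNReal.ofReal_ne_top)
    simpa only [mul_zero] using h
  have hlim2 := hlim.ennrpow_const (1 / p)
  rw [ENNReal.zero_rpow_of_pos (by positivity)] at hlim2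
  refine tendsto_of_tendsto_of_tendsto_of_le_of_le tendsto_const_nhds hlim2
    (fun n => zero_le) fun n => ?_
  simp only [sliceNorm_eq p α hJ]
  gcongr
  exact hbound n
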